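/- Let $k\ge 2$ be an integer and $0<b<1$, and set $\sigma=\frac{b}{b+k-1}$. A treasure is hidden in a box of $\{1,\dots,M\}$, in box $x$ with probability $r_{M,b}(x)=x^{-b}/\sum_{y=1}^{M}y^{-b}$. At each time step $t=1,2,\dots$ each of $k$ searchers peeks into one box (or does nothing); the running time is the first step at which some searcher peeks into the box of the treasure, and $\mathbb T_M(A)\in[0,\infty]$ denotes its expectation under algorithm $A$, over the position of the treasure and the random choices of the searchers. An algorithm is *non-coordinating* if all searchers execute the same randomized protocol independently, i.e. the sequences of boxes peeked into by the $k$ searchers are independent and identically distributed (with an arbitrary common law). Let $\mathrm{cord}$ be the coordinated algorithm in which searcher $i\in\{1,\dots,k\}$ peeks into box $(t-1)k+i$ at step $t$. Let $\mathrm{pareto}_M$ be the non-coordinating algorithm in which each searcher, at step $t$, peeks into a uniformly random box among those in $\{1,\dots,\min(M,\lfloor t/\sigma\rfloor)\}$ that it has not itself checked yet (and stops when it has checked all $M$ boxes). Then $$\lim_{M\to\infty}\frac{\mathbb T_M(\mathrm{pareto}_M)}{\mathbb T_M(\mathrm{cord})}=k\sigma(2-\sigma)+\frac{k}{k+1}(2-b)(1-\sigma)^2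 .$$ Furthermore, no non-coordinating algorithm does better in the limit: for every sequence $(A_M)_{M\ge1}$ of non-coordinating algorithms for $k$ searchers (where $A_M$ may depend on $M$, $b$ and $k$), $$\liminf_{M\to\infty}\frac{\mathbb T_M(A_M)}{\mathbb T_M(\mathrm{cord})}\ \ge\ k\sigma(2-\sigma)+\frac{k}{k+1}(2-b)(1-\sigma)^2 .$$ -/

import Mathlib

open MeasureTheory Filter Topology
open scoped ENNReal

noncomputable section

namespace ParallelSearch

/-- The boxes are the positive integers. A run of one searcher is a sequence `w : ℕ → ℕ`, where
`w t` is the box peeked into at step `t + 1`; the value `0` is not a box and means that the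
searcher does nothing at that step. For `k` searchers with joint run `w`, `findTime x w` is the
first step at which some searcher peeks into box `x` (`∞` if this never happens). -/
def findTime {k : ℕ} (x : ℕ) (w : Fin k → ℕ → ℕ) : ℝ≥0∞ :=
  ⨅ (t : ℕ) (_ : ∃ i, w i t = x), ((t : ℝ≥0∞) + 1)

/-- The expected time until the first of the `k` searchers finds the treasure, when the treasure
is in box `x` with probability `p x` and `P` is the joint law of the runs of the searchers. -/
def expectedTime {k : ℕ} (p : ℕ → ℝ≥0∞) (P : Measure (Fin k → ℕ → ℕ)) : ℝ≥0∞ :=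
  ∑' x : ℕ, p x * ∫⁻ w, findTime x w ∂P

/-- A non-coordinating algorithm is given by the law `A` of the run of a single searcher; the `k`
searchers run it independently. -/
def nonCoordinating (k : ℕ) (A : Measure (ℕ → ℕ)) : Measure (Fin k → ℕ → ℕ) :=
  Measure.pi fun _ => A

/-- The fully coordinated algorithm: searcher `i ∈ {1, …, k}` peeks into box `(t - 1) k + i` at
step `t ≥ 1` (in the indexing below both `i` and `t` start at `0`). -/
def cord (k : ℕ) : Measure (Fin k → ℕ → ℕ) :=
  Measure.dirac fun i t => t * k + (i : ℕ) + 1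

/-- The Pareto distribution with parameter `b` on the boxes `1, …, M`. -/
def paretoDist (M : ℕ) (b : ℝ) (x : ℕ) : ℝ≥0∞ :=
  if x ∈ Finset.Icc 1 M then
    ENNReal.ofReal ((1 / (x : ℝ) ^ b) / ∑ y ∈ Finset.Icc 1 M, 1 / (y : ℝ) ^ b)
  else 0

/-- The boxes in `{1, …, min(M, ⌊t/σ⌋)}` that a searcher with run `w` has not checked in its
steps `1, …, t - 1`. -/
def unchecked (σ : ℝ) (M : ℕ) (w : ℕ → ℕ) (t : ℕ) : Finset ℕ :=
  Finset.Icc 1 (min M ⌊(t : ℝ) / σ⌋₊) \ (Finset.range (t - 1)).image w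

open Classical in
/-- A uniformly random element of `s`; if `s` is empty, the value `0` (do nothing). -/
def uniformChoice (s : Finset ℕ) : PMF ℕ :=
  if hs : s.Nonempty then PMF.uniformOfFinset s hs else PMF.pure 0

/-- The random run of a searcher executing the first `n` steps of the algorithm that at step `t`
peeks into a uniformly random unchecked box of `{1, …, min(M, ⌊t/σ⌋)}`, and then stops. -/
def paretoRun (σ : ℝ) (M : ℕ) : ℕ → PMF (ℕ → ℕ)
  | 0 => PMF.pure fun _ => 0
  | n + 1 => (paretoRun σ M n).bind fun w =>
      (uniformChoice (unchecked σ M w (n + 1))).map fun x => Function.update w n x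

/-- The law of a searcher's run in the algorithm above. For `0 < σ ≤ 1` each of the first `M`
steps checks a new box, so after `M` steps no unchecked box is left. -/
def paretoAlg (σ : ℝ) (M : ℕ) : Measure (ℕ → ℕ) :=
  (paretoRun σ M M).toMeasure

end ParallelSearch

end

noncomputable section

namespace ParallelSearch

/-! The expected time is the sum over `t` of the probability that the treasure is still hidden after
`t` steps. Without coordination this is, up to normalization, the sum over `x` of `x ^ (-b) * F x ^
k`, where `F x` is the probability that one searcher misses `x` in `t` steps. The only constraint
needed on `F`, besides `0 ≤ F ≤ 1`, is the budget `∑ (1 - F x) ≤ t` of `sum_one_sub_missed_le`.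

For each fixed `t` this is a convex problem. Stationarity makes `x ^ (-b) * F x ^ (k - 1)` constant
where `F < 1`, so `F x = c * x ^ a` with `a = b / (k - 1)`, truncated at `1`. Asymptotically,
spending the budget gives `F x = min 1 ((x / N) ^ a)` with `N = t / σ`, as long as `N ≤ M`, because
`1 - 1 / (a + 1) = σ`. For later `t` all boxes are in play and `c = (M - t) / ∑ y ^ a`. Tangent
lines at these profiles turn the heuristic into the lower bounds `le_missedWeight_head` and
`le_missedWeight_tail`.

The Pareto algorithm nearly attains the optimal profile at every `t` simultaneously. A box enters
its window at time about `σ x`, and then survives each step with a factor whose product telescopes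
to about `(σ x / t) ^ a`; once the window is everything, the factors telescope to a linear decay in
`M - t` (`missProb_le_rpow`, `missProb_le_rpow_mul`).

Summed over `t`, both bounds have the same leading term of order `M ^ (2 - b)`
(`tendsto_lowerTotal`, `tendsto_upperTotal`), which is divided by that of `cord`
(`tendsto_cordSum`). -/

/-! ### Finding times as sums of miss probabilities -/

/-- The runs of a single searcher that miss box `x` in the first `t` steps. -/
def missed (x t : ℕ) : Set (ℕ → ℕ) := {w | ∀ s < t, w s ≠ x}

lemma measurableSet_apply_eq (s x : ℕ) : MeasurableSet {w : ℕ → ℕ | w s = x} :=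
  measurableSet_eq_fun (measurable_pi_apply s) measurable_const

lemma measurableSet_missed (x t : ℕ) : MeasurableSet (missed x t) := by
  have : missed x t = ⋂ s ∈ Set.Iio t, {w : ℕ → ℕ | w s = x}ᶜ := by
    ext w; simp [missed]
  rw [this]
  exact MeasurableSet.biInter (Set.to_countable _) fun s _ => (measurableSet_apply_eq s x).compl

open Classical in
/-- The finding time counts the steps before which the treasure has not been found. -/
lemma findTime_eq_tsum {k : ℕ} (x : ℕ) (w : Fin k → ℕ → ℕ) :
    findTime x w =
      ∑' t : ℕ, (Set.univ.pi fun _ : Fin k => missed x t).indicator (1 : (Fin k → ℕ → ℕ) → ℝ≥0∞) w := by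
  have hmem : ∀ t, w ∈ (Set.univ.pi fun _ : Fin k => missed x t) ↔
      ∀ s < t, ¬ ∃ i, w i s = x := by
    intro t
    simp only [Set.mem_univ_pi, missed, Set.mem_ofPred_eq, not_exists]
    exact ⟨fun h s hs i => h i s hs, fun h i s hs => h s hs i⟩
  simp only [Set.indicator_apply, hmem, Pi.one_apply]
  by_cases h : ∃ t, ∃ i, w i t = x
  · have hmin : ∀ t, (∀ s < t, ¬ ∃ i, w i s = x) ↔ t ∈ Finset.range (Nat.find h + 1) := by
      intro t
      rw [Finset.mem_range, Nat.lt_succ_iff, Nat.le_find_iff]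
    simp only [hmin]
    rw [tsum_eq_sum (s := Finset.range (Nat.find h + 1)) (fun t ht => if_neg ht),
      Finset.sum_congr rfl (fun t ht => if_pos ht), Finset.sum_const, Finset.card_range,
      nsmul_eq_mul, mul_one, Nat.cast_add, Nat.cast_one]
    rw [findTime]
    refine le_antisymm (iInf₂_le (Nat.find h) (Nat.find_spec h)) (le_iInf₂ fun t ht => ?_)
    gcongr
    exact Nat.find_min' h ht
  · have h' : ∀ t, ¬ ∃ i, w i t = x := fun t ht => h ⟨t, ht⟩
    simp [findTime, h']

lemma measurable_findTime {k : ℕ} (x : ℕ) :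
    Measurable (findTime (k := k) x) := by
  have : findTime (k := k) x = fun w =>
      ∑' t : ℕ, (Set.univ.pi fun _ : Fin k => missed x t).indicator (1 : (Fin k → ℕ → ℕ) → ℝ≥0∞) w :=
    funext fun w => findTime_eq_tsum x w
  rw [this]
  exact Measurable.tsum fun t =>
    measurable_one.indicator (MeasurableSet.univ_pi fun _ => measurableSet_missed x t)

/-- Independence turns the event that all searchers miss `x` into a product set, so only the miss
probability of a single searcher survives, to the power `k`. -/
lemma lintegral_findTime_nonCoordinating {k : ℕ} (x : ℕ) (A : Measure (ℕ → ℕ))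
    [IsProbabilityMeasure A] :
    ∫⁻ w, findTime x w ∂(nonCoordinating k A) = ∑' t : ℕ, A (missed x t) ^ k := by
  simp only [findTime_eq_tsum]
  have hm : ∀ t, MeasurableSet (Set.univ.pi fun _ : Fin k => missed x t) := fun t =>
    MeasurableSet.univ_pi fun _ => measurableSet_missed x t
  rw [lintegral_tsum fun t => (measurable_one.indicator (hm t)).aemeasurable]
  refine tsum_congr fun t => ?_
  rw [lintegral_indicator_one (hm t), nonCoordinating, Measure.pi_pi]
  simp

/-- In `t` steps a searcher checks at most `t` boxes, in expectation. -/
lemma sum_one_sub_missed_le (A : Measure (ℕ → ℕ)) [IsProbabilityMeasure A] (S : Finset ℕ)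
    (t : ℕ) : ∑ x ∈ S, (1 - A.real (missed x t)) ≤ t := by
  have hx : ∀ x, 1 - A.real (missed x t) ≤
      ∑ s ∈ Finset.range t, A.real {w : ℕ → ℕ | w s = x} := by
    intro x
    rw [← probReal_compl_eq_one_sub (measurableSet_missed x t)]
    have : (missed x t)ᶜ = ⋃ s ∈ Finset.range t, {w : ℕ → ℕ | w s = x} := by
      ext w; simp [missed]
    rw [this]
    exact measureReal_biUnion_finset_le _ _
  calc ∑ x ∈ S, (1 - A.real (missed x t))
      ≤ ∑ x ∈ S, ∑ s ∈ Finset.range t, A.real {w : ℕ → ℕ | w s = x} :=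
        Finset.sum_le_sum fun x _ => hx x
    _ = ∑ s ∈ Finset.range t, ∑ x ∈ S, A.real {w : ℕ → ℕ | w s = x} := Finset.sum_comm
    _ ≤ ∑ s ∈ Finset.range t, 1 := by
        refine Finset.sum_le_sum fun s _ => ?_
        rw [← measureReal_biUnion_finset
          (fun x _ y _ hxy => Set.disjoint_left.2 fun w hw hw' => hxy (hw.symm.trans hw'))
          (fun x _ => measurableSet_apply_eq s x)]
        exact measureReal_le_one
    _ = t := by simp

lemma lintegral_findTime_cord {k : ℕ} (hk : 0 < k) {x : ℕ} (hx : 1 ≤ x) :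
    ∫⁻ w, findTime x w ∂(cord k) = (((x - 1) / k : ℕ) : ℝ≥0∞) + 1 := by
  rw [cord, lintegral_dirac' _ (measurable_findTime x), findTime]
  have hmod := Nat.div_add_mod' (x - 1) k
  refine le_antisymm (iInf₂_le ((x - 1) / k)
    ⟨⟨(x - 1) % k, Nat.mod_lt _ hk⟩, by simp only; omega⟩) (le_iInf₂ ?_)
  rintro t ⟨i, hi⟩
  gcongr
  have : x - 1 = i + t * k := by omega
  rw [this, Nat.add_mul_div_right _ _ hk, Nat.div_eq_of_lt i.2, zero_add]

/-- The expected running time without the normalization of the Pareto distribution. -/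
def weightedTime {k : ℕ} (b : ℝ) (M : ℕ) (P : Measure (Fin k → ℕ → ℕ)) : ℝ≥0∞ :=
  ∑ x ∈ Finset.Icc 1 M, ENNReal.ofReal ((x : ℝ) ^ (-b)) * ∫⁻ w, findTime x w ∂P

lemma sum_rpow_neg_pos {b : ℝ} {M : ℕ} (hM : 1 ≤ M) :
    0 < ∑ y ∈ Finset.Icc 1 M, 1 / (y : ℝ) ^ b := by
  refine Finset.sum_pos (fun y hy => ?_) ⟨1, by simp [hM]⟩
  have : 0 < (y : ℝ) := by exact_mod_cast (Finset.mem_Icc.1 hy).1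
  positivity

lemma expectedTime_paretoDist {k : ℕ} (b : ℝ) (M : ℕ) (P : Measure (Fin k → ℕ → ℕ)) :
    expectedTime (paretoDist M b) P =
      ENNReal.ofReal (∑ y ∈ Finset.Icc 1 M, 1 / (y : ℝ) ^ b)⁻¹ * weightedTime b M P := by
  rw [expectedTime, tsum_eq_sum (s := Finset.Icc 1 M), weightedTime, Finset.mul_sum]
  · refine Finset.sum_congr rfl fun x hx => ?_
    rw [paretoDist, if_pos hx, ← mul_assoc, ← ENNReal.ofReal_mul (by positivity),
      Real.rpow_neg (by positivity)]
    congr 2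
    ring
  · intro x hx
    simp [paretoDist, hx]

/-- The normalizing constant of the distribution cancels, so everything below works with the raw
weights `x ^ (-b)`. -/
lemma expectedTime_div_expectedTime {k : ℕ} (b : ℝ) {M : ℕ} (hM : 1 ≤ M)
    (P P' : Measure (Fin k → ℕ → ℕ)) :
    expectedTime (paretoDist M b) P / expectedTime (paretoDist M b) P' =
      weightedTime b M P / weightedTime b M P' := by
  rw [expectedTime_paretoDist, expectedTime_paretoDist, ENNReal.mul_div_mul_left]
  · simpa using sum_rpow_neg_pos hM
  · exact ENNReal.ofReal_ne_top

lemma weightedTime_cord {k : ℕ} (hk : 0 < k) (b : ℝ) (M : ℕ) :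
    weightedTime b M (cord k) = ENNReal.ofReal
      (∑ x ∈ Finset.Icc 1 M, (x : ℝ) ^ (-b) * ((((x - 1) / k : ℕ) : ℝ) + 1)) := by
  rw [ENNReal.ofReal_sum_of_nonneg fun x _ => by positivity]
  refine Finset.sum_congr rfl fun x hx => ?_
  rw [lintegral_findTime_cord hk (Finset.mem_Icc.1 hx).1, ENNReal.ofReal_mul (by positivity),
    ENNReal.ofReal_add (by positivity) zero_le_one]
  simp

/-- The weight of the boxes that all `k` searchers with law `A` miss in `t` steps, on average. -/
def missedWeight (k : ℕ) (b : ℝ) (A : Measure (ℕ → ℕ)) (M t : ℕ) : ℝ :=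
  ∑ x ∈ Finset.Icc 1 M, (x : ℝ) ^ (-b) * A.real (missed x t) ^ k

lemma missedWeight_nonneg (k : ℕ) (b : ℝ) (A : Measure (ℕ → ℕ)) (M t : ℕ) :
    0 ≤ missedWeight k b A M t :=
  Finset.sum_nonneg fun x _ => by positivity

lemma weightedTime_nonCoordinating {k : ℕ} (b : ℝ) (A : Measure (ℕ → ℕ))
    [IsProbabilityMeasure A] (M : ℕ) :
    weightedTime b M (nonCoordinating k A) =
      ∑' t : ℕ, ENNReal.ofReal (missedWeight k b A M t) := by
  simp only [weightedTime, lintegral_findTime_nonCoordinating, ← ENNReal.tsum_mul_left]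
  rw [← Summable.tsum_finsetSum fun _ _ => ENNReal.summable]
  refine tsum_congr fun t => ?_
  rw [missedWeight, ENNReal.ofReal_sum_of_nonneg fun x _ => by positivity]
  refine Finset.sum_congr rfl fun x _ => ?_
  rw [ENNReal.ofReal_mul (by positivity), ENNReal.ofReal_pow measureReal_nonneg,
    ofReal_measureReal]

/-! ### Power asymptotics of sums -/

/-- After factoring out powers of `n`, this is the difference quotient of `x ^ (q + 1)` at `1` with
increment `1 / n`. -/
lemma tendsto_rpow_succ_sub_div (q : ℝ) :
    Tendsto (fun n : ℕ => (((n : ℝ) + 1) ^ (q + 1) - (n : ℝ) ^ (q + 1)) / (n : ℝ) ^ q) atTop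
      (𝓝 (q + 1)) := by
  have hd : HasDerivAt (fun x : ℝ => x ^ (q + 1)) (q + 1) 1 := by
    simpa using Real.hasDerivAt_rpow_const (x := 1) (p := q + 1) (Or.inl one_ne_zero)
  have h := hd.tendsto_slope_zero_right
  have hinv : Tendsto (fun n : ℕ => ((n : ℝ))⁻¹) atTop (𝓝[>] 0) :=
    tendsto_inv_atTop_nhdsGT_zero.comp tendsto_natCast_atTop_atTop
  refine (h.comp hinv).congr' ?_
  filter_upwards [eventually_gt_atTop 0] with n hn
  have hn' : (0 : ℝ) < n := by exact_mod_cast hn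
  have e : (n : ℝ) + 1 = n * (1 + (n : ℝ)⁻¹) := by field_simp
  simp only [Function.comp_apply, inv_inv, smul_eq_mul, Real.one_rpow]
  rw [e, Real.mul_rpow hn'.le (by positivity), Real.rpow_add_one hn'.ne']
  field_simp

/-- Cesàro summation of a sequence that is asymptotic to a multiple of a power. -/
lemma tendsto_sum_range_div_rpow {h : ℕ → ℝ} {q L : ℝ} (hq : -1 < q)
    (hh : Tendsto (fun n : ℕ => h n / (n : ℝ) ^ q) atTop (𝓝 L)) :
    Tendsto (fun n : ℕ => (∑ t ∈ Finset.range n, h t) / (n : ℝ) ^ (q + 1)) atTop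
      (𝓝 (L / (q + 1))) := by
  have hq1 : 0 < q + 1 := by linarith
  set v : ℕ → ℝ := fun n => ((n : ℝ) + 1) ^ (q + 1) - (n : ℝ) ^ (q + 1) with hv
  have hsum : ∀ n, ∑ t ∈ Finset.range n, v t = (n : ℝ) ^ (q + 1) := by
    intro n
    have := Finset.sum_range_sub (fun n : ℕ => (n : ℝ) ^ (q + 1)) n
    simpa [hv, Real.zero_rpow hq1.ne'] using this
  have hvpos : ∀ n, 0 < v n := fun n =>
    sub_pos.2 (Real.rpow_lt_rpow (by positivity) (by linarith) hq1)
  have hvq := tendsto_rpow_succ_sub_div q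
  have hratio : Tendsto (fun n => (h n - L / (q + 1) * v n) / v n) atTop (𝓝 0) := by
    have h1 : Tendsto (fun n : ℕ => (h n / (n : ℝ) ^ q) / (v n / (n : ℝ) ^ q) - L / (q + 1)) atTop
        (𝓝 (L / (q + 1) - L / (q + 1))) := (hh.div hvq hq1.ne').sub_const _
    rw [sub_self] at h1
    refine h1.congr' ?_
    filter_upwards [eventually_gt_atTop 0] with n hn
    have hn' : (0 : ℝ) < n := by exact_mod_cast hn
    have := (hvpos n).ne'
    have := (Real.rpow_pos_of_pos hn' q).ne'
    field_simp
  -- Stolz–Cesàro: the error is negligible against the positive increments `v`, whose partial sums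
  -- telescope and diverge, so its partial sums are negligible too.
  have ho : (fun n => h n - L / (q + 1) * v n) =o[atTop] v :=
    (Asymptotics.isLittleO_iff_tendsto' (Eventually.of_forall fun n hn =>
      absurd hn (hvpos n).ne')).2 hratio
  have htop : Tendsto (fun n => ∑ t ∈ Finset.range n, v t) atTop atTop := by
    simp only [hsum]
    exact (tendsto_rpow_atTop hq1).comp tendsto_natCast_atTop_atTop
  have hs := (ho.sum_range (fun n => (hvpos n).le) htop).tendsto_div_nhds_zero
  simp only [Finset.sum_sub_distrib, ← Finset.mul_sum, hsum] at hs
  have := hs.add_const (L / (q + 1))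
  rw [zero_add] at this
  refine this.congr' ?_
  filter_upwards [eventually_gt_atTop 0] with n hn
  have hn' : (0 : ℝ) < n := by exact_mod_cast hn
  have := (Real.rpow_pos_of_pos hn' (q + 1)).ne'
  field_simp
  ring

/-- Composition of power asymptotics with an asymptotically linear sequence. -/
lemma tendsto_comp_div_rpow {f : ℕ → ℝ} {q L c : ℝ} {u : ℕ → ℕ} (hc : 0 < c)
    (hf : Tendsto (fun n : ℕ => f n / (n : ℝ) ^ q) atTop (𝓝 L))
    (hu : Tendsto (fun n : ℕ => (u n : ℝ) / n) atTop (𝓝 c)) :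
    Tendsto (fun n : ℕ => f (u n) / (n : ℝ) ^ q) atTop (𝓝 (L * c ^ q)) := by
  have hu' : Tendsto u atTop atTop := by
    rw [← tendsto_natCast_atTop_iff (R := ℝ)]
    refine (hu.pos_mul_atTop hc tendsto_natCast_atTop_atTop).congr' ?_
    filter_upwards [eventually_gt_atTop 0] with n hn
    have hn' : (0 : ℝ) < n := by exact_mod_cast hn
    field_simp
  have h2 := (hf.comp hu').mul (hu.rpow_const (p := q) (Or.inl hc.ne'))
  refine h2.congr' ?_
  filter_upwards [eventually_gt_atTop 0, hu'.eventually_gt_atTop 0] with n hn hun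
  have hn' : (0 : ℝ) < n := by exact_mod_cast hn
  have hun' : (0 : ℝ) < u n := by exact_mod_cast hun
  have := (Real.rpow_pos_of_pos hn' q).ne'
  have := (Real.rpow_pos_of_pos hun' q).ne'
  simp only [Function.comp_apply]
  rw [Real.div_rpow hun'.le hn'.le]
  field_simp

lemma tendsto_add_one_div : Tendsto (fun n : ℕ => ((n + 1 : ℕ) : ℝ) / n) atTop (𝓝 1) := by
  have := (tendsto_inv_atTop_nhds_zero_nat (𝕜 := ℝ)).const_add 1
  rw [add_zero] at this
  refine this.congr' ?_
  filter_upwards [eventually_gt_atTop 0] with n hn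
  have hn' : (0 : ℝ) < n := by exact_mod_cast hn
  push_cast
  field_simp

lemma tendsto_sum_Icc_div_rpow {h : ℕ → ℝ} {q L : ℝ} (hq : -1 < q)
    (hh : Tendsto (fun n : ℕ => h n / (n : ℝ) ^ q) atTop (𝓝 L)) :
    Tendsto (fun n : ℕ => (∑ t ∈ Finset.Icc 1 n, h t) / (n : ℝ) ^ (q + 1)) atTop
      (𝓝 (L / (q + 1))) := by
  have h1 := tendsto_comp_div_rpow one_pos hh tendsto_add_one_div
  rw [Real.one_rpow, mul_one] at h1
  refine (tendsto_sum_range_div_rpow hq h1).congr fun n => ?_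
  rw [← Finset.Ico_add_one_right_eq_Icc, Finset.sum_Ico_eq_sum_range]
  simp [add_comm]

lemma tendsto_rpow_div_rpow (q : ℝ) :
    Tendsto (fun n : ℕ => (n : ℝ) ^ q / (n : ℝ) ^ q) atTop (𝓝 1) := by
  refine tendsto_const_nhds.congr' ?_
  filter_upwards [eventually_gt_atTop 0] with n hn
  have hn' : (0 : ℝ) < n := by exact_mod_cast hn
  exact (div_self (Real.rpow_pos_of_pos hn' q).ne').symm

lemma tendsto_sum_rpow_div {q : ℝ} (hq : -1 < q) :
    Tendsto (fun n : ℕ => (∑ t ∈ Finset.Icc 1 n, (t : ℝ) ^ q) / (n : ℝ) ^ (q + 1)) atTop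
      (𝓝 (1 / (q + 1))) :=
  tendsto_sum_Icc_div_rpow hq (tendsto_rpow_div_rpow q)

/-! ### Miss probabilities of the Pareto algorithm -/

lemma missed_anti (x : ℕ) {s t : ℕ} (h : s ≤ t) : missed x t ⊆ missed x s :=
  fun _ hw r hr => hw r (hr.trans_le h)

lemma succ_le_window {σ : ℝ} (hσ0 : 0 < σ) (hσ1 : σ ≤ 1) {M n : ℕ} (hn : n < M) :
    n + 1 ≤ min M ⌊((n + 1 : ℕ) : ℝ) / σ⌋₊ := by
  refine le_min hn (Nat.le_floor ?_)
  rw [le_div_iff₀ hσ0]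
  exact mul_le_of_le_one_right (by positivity) hσ1

lemma window_mono {σ : ℝ} (hσ0 : 0 < σ) (M : ℕ) {s t : ℕ} (h : s ≤ t) :
    min M ⌊(s : ℝ) / σ⌋₊ ≤ min M ⌊(t : ℝ) / σ⌋₊ := by
  gcongr

/-- The windows are nested, so all boxes checked earlier lie in the current one; the number of
unchecked boxes therefore does not depend on the history. -/
lemma card_unchecked {σ : ℝ} (hσ0 : 0 < σ) {M n : ℕ} {w : ℕ → ℕ}
    (hinj : Set.InjOn w (Finset.range n))
    (hw : ∀ s < n, w s ∈ Finset.Icc 1 (min M ⌊((s + 1 : ℕ) : ℝ) / σ⌋₊)) :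
    (unchecked σ M w (n + 1)).card = min M ⌊((n + 1 : ℕ) : ℝ) / σ⌋₊ - n := by
  rw [unchecked, Nat.add_sub_cancel, Finset.card_sdiff_of_subset, Finset.card_image_of_injOn hinj,
    Finset.card_range, Nat.card_Icc, Nat.add_sub_cancel]
  intro x hx
  obtain ⟨s, hs, rfl⟩ := Finset.mem_image.1 hx
  have hs := Finset.mem_range.1 hs
  have := Finset.mem_Icc.1 (hw s hs)
  exact Finset.mem_Icc.2 ⟨this.1, this.2.trans (window_mono hσ0 M (by omega))⟩

lemma uniformChoice_of_nonempty {s : Finset ℕ} (hs : s.Nonempty) :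
    uniformChoice s = PMF.uniformOfFinset s hs := dif_pos hs

/-- In its first `n ≤ M` steps the searcher checks `n` distinct boxes of the allowed windows. -/
lemma paretoRun_support {σ : ℝ} (hσ0 : 0 < σ) (hσ1 : σ ≤ 1) {M n : ℕ} (hn : n ≤ M)
    {w : ℕ → ℕ} (hw : w ∈ (paretoRun σ M n).support) :
    Set.InjOn w (Finset.range n) ∧
      ∀ s < n, w s ∈ Finset.Icc 1 (min M ⌊((s + 1 : ℕ) : ℝ) / σ⌋₊) := by
  induction n generalizing w with
  | zero => simp
  | succ n ih =>
    rw [paretoRun, PMF.mem_support_bind_iff] at hw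
    obtain ⟨v, hv, hw⟩ := hw
    rw [PMF.mem_support_map_iff] at hw
    obtain ⟨y, hy, rfl⟩ := hw
    obtain ⟨hinj, hwin⟩ := ih (by omega) hv
    have hcard := card_unchecked hσ0 hinj hwin
    have hlt := succ_le_window hσ0 hσ1 (show n < M by omega)
    have hne : (unchecked σ M v (n + 1)).Nonempty := by
      rw [← Finset.card_pos]; omega
    rw [uniformChoice_of_nonempty hne, PMF.mem_support_uniformOfFinset_iff] at hy
    have hy' := Finset.mem_sdiff.1 hy
    have hyv : ∀ s < n, v s ≠ y := fun s hs h =>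
      hy'.2 (Finset.mem_image.2 ⟨s, by simpa using hs, h⟩)
    constructor
    · intro s hs t ht hst
      have hs : s < n + 1 := by simpa using hs
      have ht : t < n + 1 := by simpa using ht
      rcases Nat.lt_succ_iff_lt_or_eq.1 hs with hs' | rfl <;>
        rcases Nat.lt_succ_iff_lt_or_eq.1 ht with ht' | rfl
      · rw [Function.update_of_ne hs'.ne, Function.update_of_ne ht'.ne] at hst
        exact hinj (by simpa using hs') (by simpa using ht') hst
      · rw [Function.update_of_ne hs'.ne, Function.update_self] at hst
        exact absurd hst (hyv s hs')
      · rw [Function.update_of_ne ht'.ne, Function.update_self] at hst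
        exact absurd hst.symm (hyv t ht')
      · rfl
    · intro s hs
      rcases Nat.lt_succ_iff_lt_or_eq.1 hs with hs' | rfl
      · rw [Function.update_of_ne hs'.ne]
        exact hwin s hs'
      · rw [Function.update_self]
        exact hy'.1

/-- Conditioning on the first `n` steps: `c` bounds the conditional probability of `E'` on histories
in `E`, and `E'` is null after any other history. -/
lemma paretoRun_succ_le {σ : ℝ} {M n : ℕ} {E E' : Set (ℕ → ℕ)} (hE : MeasurableSet E)
    (hE' : MeasurableSet E') (c : ℝ≥0∞)
    (h : ∀ w ∈ (paretoRun σ M n).support,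
      (uniformChoice (unchecked σ M w (n + 1))).toMeasure {y | Function.update w n y ∈ E'} ≤
        E.indicator (fun _ => c) w) :
    (paretoRun σ M (n + 1)).toMeasure E' ≤ c * (paretoRun σ M n).toMeasure E := by
  rw [paretoRun, PMF.toMeasure_bind_apply _ _ _ hE', PMF.toMeasure_apply _ hE,
    ← ENNReal.tsum_mul_left]
  refine ENNReal.tsum_le_tsum fun w => ?_
  by_cases hw : paretoRun σ M n w = 0
  · simp [hw]
  · rw [PMF.toMeasure_map_apply _ _ _ measurable_from_top hE']
    refine (mul_le_mul_right (h w hw) _).trans (le_of_eq ?_)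
    by_cases hwE : w ∈ E <;> simp [hwE, mul_comm]

lemma update_mem_missed_succ {w : ℕ → ℕ} {n x y : ℕ} :
    Function.update w n y ∈ missed x (n + 1) ↔ w ∈ missed x n ∧ y ≠ x := by
  constructor
  · intro h
    refine ⟨fun s hs => ?_, ?_⟩
    · have := h s (by omega)
      rwa [Function.update_of_ne hs.ne] at this
    · have := h n (by omega)
      rwa [Function.update_self] at this
  · rintro ⟨h, hy⟩ s hs
    rcases Nat.lt_succ_iff_lt_or_eq.1 hs with hs' | rfl
    · rw [Function.update_of_ne hs'.ne]
      exact h s hs'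
    · rwa [Function.update_self]

lemma update_mem_missed {w : ℕ → ℕ} {n t x y : ℕ} (h : t ≤ n) :
    Function.update w n y ∈ missed x t ↔ w ∈ missed x t := by
  refine forall₂_congr fun s hs => ?_
  rw [Function.update_of_ne (hs.trans_le h).ne]

/-- The probability that `n` steps of the algorithm miss box `x`. -/
def missProb (σ : ℝ) (M x n : ℕ) : ℝ := (paretoRun σ M n).toMeasure.real (missed x n)

lemma missProb_nonneg (σ : ℝ) (M x n : ℕ) : 0 ≤ missProb σ M x n := measureReal_nonneg

lemma missProb_le_one (σ : ℝ) (M x n : ℕ) : missProb σ M x n ≤ 1 := measureReal_le_one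

lemma paretoAlg_missed_le (σ : ℝ) {M t : ℕ} (ht : t ≤ M) (x : ℕ) :
    (paretoAlg σ M).real (missed x t) ≤ missProb σ M x t := by
  have h : ∀ n, t ≤ n → (paretoRun σ M n).toMeasure (missed x t) ≤
      (paretoRun σ M t).toMeasure (missed x t) := by
    intro n hn
    induction n, hn using Nat.le_induction with
    | base => exact le_rfl
    | succ n hn ih =>
      refine (paretoRun_succ_le (measurableSet_missed x t) (measurableSet_missed x t) 1
        fun w _ => ?_).trans ((one_mul _).trans_le ih)
      simp only [update_mem_missed hn]
      by_cases hw : w ∈ missed x t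
      · rw [Set.indicator_of_mem hw]
        exact prob_le_one
      · simp [hw]
  exact ENNReal.toReal_mono (measure_ne_top _ _) (h M ht)

/-- A box of the window not yet checked is one of exactly `N - n` equally likely choices, `N` being
the window size. -/
lemma missProb_succ_le {σ : ℝ} (hσ0 : 0 < σ) (hσ1 : σ ≤ 1) {M n x : ℕ} (hn : n < M)
    (hx : 1 ≤ x) (hxN : x ≤ min M ⌊((n + 1 : ℕ) : ℝ) / σ⌋₊) :
    missProb σ M x (n + 1) ≤
      (1 - 1 / ((min M ⌊((n + 1 : ℕ) : ℝ) / σ⌋₊ : ℕ) - n : ℝ)) * missProb σ M x n := by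
  set N := min M ⌊((n + 1 : ℕ) : ℝ) / σ⌋₊ with hN
  have hnN : n + 1 ≤ N := succ_le_window hσ0 hσ1 hn
  have hnN' : (n : ℝ) + 1 ≤ N := by exact_mod_cast hnN
  have hc : 0 ≤ 1 - 1 / ((N : ℝ) - n) := by
    rw [sub_nonneg, div_le_one (by linarith)]
    linarith
  have key := paretoRun_succ_le (σ := σ) (M := M) (n := n) (measurableSet_missed x n)
    (measurableSet_missed x (n + 1)) (ENNReal.ofReal (1 - 1 / ((N : ℝ) - n))) ?_
  · have := ENNReal.toReal_mono (ENNReal.mul_ne_top ENNReal.ofReal_ne_top (measure_ne_top _ _)) key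
    rwa [ENNReal.toReal_mul, ENNReal.toReal_ofReal hc] at this
  · intro w hw
    obtain ⟨hinj, hwin⟩ := paretoRun_support hσ0 hσ1 hn.le hw
    have hcard := card_unchecked hσ0 hinj hwin
    rw [← hN] at hcard
    simp only [update_mem_missed_succ]
    by_cases hwx : w ∈ missed x n
    · have hxu : x ∈ unchecked σ M w (n + 1) := by
        refine Finset.mem_sdiff.2 ⟨Finset.mem_Icc.2 ⟨hx, hxN⟩, fun h => ?_⟩
        obtain ⟨s, hs, hsx⟩ := Finset.mem_image.1 h
        exact hwx s (by simpa using hs) hsx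
      have hne : (unchecked σ M w (n + 1)).Nonempty := ⟨x, hxu⟩
      rw [Set.indicator_of_mem hwx, uniformChoice_of_nonempty hne]
      have hset : {y | w ∈ missed x n ∧ y ≠ x} = ({x} : Set ℕ)ᶜ := by
        ext y; simp [hwx]
      rw [hset, prob_compl_eq_one_sub (MeasurableSet.singleton x),
        PMF.toMeasure_apply_singleton _ _ (MeasurableSet.singleton x),
        PMF.uniformOfFinset_apply_of_mem hne hxu, hcard,
        ENNReal.ofReal_sub _ (one_div_nonneg.2 (by linarith)), ENNReal.ofReal_one, one_div,
        ENNReal.ofReal_inv_of_pos (by linarith), ENNReal.ofReal_sub _ (by positivity)]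
      simp
    · simp [hwx]

/-- Bernoulli's inequality `(1 + 1 / s) ^ a ≤ 1 + a / s`, which needs `a ≤ 1`. The bound has the
form `(s / (s + 1)) ^ a` so that consecutive factors telescope. -/
lemma factor_le_rpow {a s c : ℝ} (ha0 : 0 < a) (ha1 : a ≤ 1) (hs : 0 < s) (hc : 0 < c)
    (hcs : c ≤ s / a + 1) : 1 - 1 / c ≤ (s / (s + 1)) ^ a := by
  have h1 : 1 - 1 / c ≤ 1 - 1 / (s / a + 1) := by gcongr
  have h2 : 1 - 1 / (s / a + 1) = (1 + a * (1 / s))⁻¹ := by field_simp; ring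
  have hs1 : 0 < 1 / s := by positivity
  have h3 : (1 + 1 / s) ^ a ≤ 1 + a * (1 / s) :=
    rpow_one_add_le_one_add_mul_self (by linarith) ha0.le ha1
  have h4 : s / (s + 1) = (1 + 1 / s)⁻¹ := by field_simp
  rw [h4, Real.inv_rpow (by positivity)]
  refine (h1.trans_eq h2).trans ?_
  gcongr

/-- While `t ≤ σ x` the bound is at least `1`; once `x` is in the window, the one-step factors
telescope. The shifts by `1` absorb the rounding. -/
lemma missProb_le_rpow {σ a : ℝ} (hσ0 : 0 < σ) (hσ1 : σ < 1) (ha : a = σ / (1 - σ))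
    (ha1 : a ≤ 1) {M t x : ℕ} (ht : t ≤ M) (hx : 1 ≤ x) (hxM : x ≤ M) :
    missProb σ M x t ≤ ((σ * x + 1) / (t + 1)) ^ a := by
  have ha0 : 0 < a := by rw [ha]; exact div_pos hσ0 (by linarith)
  induction t with
  | zero =>
    refine (missProb_le_one _ _ _ _).trans (Real.one_le_rpow ?_ ha0.le)
    have : 0 ≤ σ * x := by positivity
    simpa
  | succ t ih =>
    by_cases hxt : σ * x ≤ t + 1
    · have hxf : x ≤ ⌊((t + 1 : ℕ) : ℝ) / σ⌋₊ := by
        refine Nat.le_floor ?_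
        rw [le_div_iff₀ hσ0]
        push_cast
        linarith
      refine (missProb_succ_le hσ0 hσ1.le ht hx (le_min hxM hxf)).trans ?_
      have hnN : ((t + 1 : ℕ) : ℝ) ≤ (min M ⌊((t + 1 : ℕ) : ℝ) / σ⌋₊ : ℕ) := by
        exact_mod_cast succ_le_window hσ0 hσ1.le ht
      have hN : ((min M ⌊((t + 1 : ℕ) : ℝ) / σ⌋₊ : ℕ) : ℝ) ≤ ((t + 1 : ℕ) : ℝ) / σ :=
        (Nat.cast_le.2 (min_le_right _ _)).trans (Nat.floor_le (by positivity))
      -- At most `(t + 1) / σ - t = (t + 1) / a + 1` boxes are unchecked, since `1 / σ - 1 = 1 / a`.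
      have hfac := factor_le_rpow (s := (t : ℝ) + 1) ha0 ha1 (by positivity)
        (c := ((min M ⌊((t + 1 : ℕ) : ℝ) / σ⌋₊ : ℕ) : ℝ) - t)
        (by push_cast at hnN ⊢; linarith) (by
          have : ((t : ℝ) + 1) / a = ((t + 1 : ℕ) : ℝ) / σ - (t + 1) := by
            have : 1 - σ ≠ 0 := by linarith
            rw [ha]; push_cast; field_simp
          linarith)
      calc _ ≤ (((t : ℝ) + 1) / (t + 1 + 1)) ^ a * ((σ * x + 1) / (t + 1)) ^ a := by
            gcongr
            · exact missProb_nonneg _ _ _ _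
            · exact ih (by omega)
        _ = ((σ * x + 1) / ((t + 1 : ℕ) + 1)) ^ a := by
            rw [← Real.mul_rpow (by positivity) (by positivity)]
            congr 1
            push_cast
            field_simp
    · refine (missProb_le_one _ _ _ _).trans (Real.one_le_rpow ?_ ha0.le)
      rw [le_div_iff₀ (by positivity)]
      push_cast
      linarith

/-- From time `⌊σ * M⌋₊` on, each further step has all boxes in its window, so the survival factors
`(M - t - 1) / (M - t)` telescope and no longer depend on `x`. -/
lemma missProb_le_rpow_mul {σ a : ℝ} (hσ0 : 0 < σ) (hσ1 : σ < 1) (ha : a = σ / (1 - σ))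
    (ha1 : a ≤ 1) {M t x : ℕ} (hst : ⌊σ * M⌋₊ ≤ t) (ht : t ≤ M) (hx : 1 ≤ x) (hxM : x ≤ M) :
    missProb σ M x t ≤
      ((σ * x + 1) / (⌊σ * M⌋₊ + 1)) ^ a * ((M - t) / (M - ⌊σ * M⌋₊)) := by
  have hM : (1 : ℝ) ≤ M := by exact_mod_cast hx.trans hxM
  have hs1 : (⌊σ * M⌋₊ : ℝ) < M :=
    (Nat.floor_le (by positivity)).trans_lt (by nlinarith)
  induction t, hst using Nat.le_induction with
  | base =>
    rw [div_self (by linarith), mul_one]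
    exact missProb_le_rpow hσ0 hσ1 ha ha1 ht hx hxM
  | succ t hst ih =>
    have hlt : σ * M < t + 1 :=
      (Nat.lt_floor_add_one _).trans_le (by exact_mod_cast Nat.succ_le_succ hst)
    have hxM' : (x : ℝ) ≤ M := by exact_mod_cast hxM
    have hxf : x ≤ ⌊((t + 1 : ℕ) : ℝ) / σ⌋₊ := by
      refine Nat.le_floor ?_
      rw [le_div_iff₀ hσ0]
      push_cast
      nlinarith
    refine (missProb_succ_le hσ0 hσ1.le ht hx (le_min hxM hxf)).trans ?_
    have hnN : ((t + 1 : ℕ) : ℝ) ≤ (min M ⌊((t + 1 : ℕ) : ℝ) / σ⌋₊ : ℕ) := by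
      exact_mod_cast succ_le_window hσ0 hσ1.le ht
    push_cast at hnN
    have hN : ((min M ⌊((t + 1 : ℕ) : ℝ) / σ⌋₊ : ℕ) : ℝ) ≤ M :=
      Nat.cast_le.2 (min_le_left _ _)
    have htM : (t : ℝ) + 1 ≤ M := by exact_mod_cast ht
    calc _ ≤ (1 - 1 / ((M : ℝ) - t)) *
          (((σ * x + 1) / (⌊σ * M⌋₊ + 1)) ^ a * ((M - t) / (M - ⌊σ * M⌋₊))) := by
          gcongr
          · exact missProb_nonneg _ _ _ _
          · rw [sub_nonneg, div_le_one (by linarith)]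
            linarith
          · push_cast
            linarith
          · exact ih (by omega)
      _ = _ := by
          have : (M : ℝ) - t ≠ 0 := by linarith
          have : (M : ℝ) - ⌊σ * M⌋₊ ≠ 0 := by linarith
          push_cast
          field_simp
          ring

/-! ### Convex lower bound at a fixed step -/

/-- The sum of the `q`-th powers of `1, …, n`. -/
def powSum (q : ℝ) (n : ℕ) : ℝ := ∑ x ∈ Finset.Icc 1 n, (x : ℝ) ^ q

lemma powSum_pos (q : ℝ) {n : ℕ} (hn : 1 ≤ n) : 0 < powSum q n := by
  refine Finset.sum_pos (fun y hy => ?_) ⟨1, by simp [hn]⟩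
  have : 0 < (y : ℝ) := by exact_mod_cast (Finset.mem_Icc.1 hy).1
  positivity

lemma sum_Icc_one_split {N M : ℕ} (h : N ≤ M) (f : ℕ → ℝ) :
    ∑ x ∈ Finset.Icc 1 M, f x = ∑ x ∈ Finset.Icc 1 N, f x + ∑ x ∈ Finset.Ioc N M, f x := by
  have := Finset.sum_Ioc_consecutive f (Nat.zero_le N) h
  rw [← Finset.Icc_add_one_left_eq_Ioc, ← Finset.Icc_add_one_left_eq_Ioc 0 M] at this
  exact this.symm

lemma tangent_le_pow {F G : ℝ} (hF : 0 ≤ F) (hG : 0 < G) (k : ℕ) :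
    G ^ k + k * G ^ (k - 1) * (F - G) ≤ F ^ k := by
  rcases Nat.eq_zero_or_pos k with rfl | hk
  · simp
  have hFG : 0 ≤ F / G := by positivity
  have h := one_add_mul_le_pow (a := F / G - 1) (by linarith) k
  rw [add_sub_cancel, div_pow, le_div_iff₀ (by positivity)] at h
  refine le_trans (le_of_eq ?_) h
  obtain ⟨m, rfl⟩ : ∃ m, k = m + 1 := ⟨k - 1, by omega⟩
  rw [Nat.add_sub_cancel]
  field_simp
  ring

/-- Tangent lines at the profile `c * x ^ a`: this exponent makes the slopes `k * x ^ (-b) * (c * x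
^ a) ^ (k - 1)` independent of `x`, so `F` enters the bound only through its sum. -/
lemma tangent_le_sum {k : ℕ} (hk : 1 ≤ k) {a b : ℝ} (hab : a * (k - 1 : ℕ) = b) {c : ℝ}
    (hc : 0 < c) {F : ℕ → ℝ} (hF : ∀ x, 0 ≤ F x) (n : ℕ) :
    c ^ k * powSum a n + k * c ^ (k - 1) * (∑ x ∈ Finset.Icc 1 n, F x - c * powSum a n) ≤
      ∑ x ∈ Finset.Icc 1 n, (x : ℝ) ^ (-b) * F x ^ k := by
  rw [powSum, Finset.mul_sum, Finset.mul_sum, ← Finset.sum_sub_distrib, Finset.mul_sum,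
    ← Finset.sum_add_distrib]
  refine Finset.sum_le_sum fun x hx => ?_
  have hx0 : 0 < (x : ℝ) := by exact_mod_cast (Finset.mem_Icc.1 hx).1
  have hxb : 0 < (x : ℝ) ^ b := by positivity
  have h1 : ((x : ℝ) ^ a) ^ (k - 1) = (x : ℝ) ^ b := by
    rw [← Real.rpow_natCast, ← Real.rpow_mul hx0.le, hab]
  have h2 : ((x : ℝ) ^ a) ^ k = (x : ℝ) ^ b * (x : ℝ) ^ a := by
    rw [← h1, ← pow_succ, Nat.sub_add_cancel hk]
  have h := mul_le_mul_of_nonneg_left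
    (tangent_le_pow (hF x) (show 0 < c * (x : ℝ) ^ a by positivity) k)
    (show 0 ≤ (x : ℝ) ^ (-b) by positivity)
  refine le_trans (le_of_eq ?_) h
  rw [mul_pow, mul_pow, h1, h2, Real.rpow_neg hx0.le]
  field_simp

lemma le_missedWeight_tail {k : ℕ} (hk : 1 ≤ k) {a b : ℝ} (hab : a * (k - 1 : ℕ) = b)
    (A : Measure (ℕ → ℕ)) [IsProbabilityMeasure A] {M t : ℕ} (ht : t < M) :
    ((M : ℝ) - t) ^ k / powSum a M ^ (k - 1) ≤ missedWeight k b A M t := by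
  have hQ : 0 < powSum a M := powSum_pos a (by omega)
  have hMt : 0 < (M : ℝ) - t := sub_pos.2 (by exact_mod_cast ht)
  -- This `c` makes the profile sum to `M - t`, the least total the budget allows, so the linear
  -- term is nonnegative.
  refine le_trans ?_ (tangent_le_sum hk hab (c := ((M : ℝ) - t) / powSum a M) (by positivity)
    (F := fun x => A.real (missed x t)) (fun x => measureReal_nonneg) M)
  have hsum := sum_one_sub_missed_le A (Finset.Icc 1 M) t
  rw [Finset.sum_sub_distrib] at hsum
  simp only [Finset.sum_const, Nat.card_Icc, Nat.add_sub_cancel, nsmul_eq_mul, mul_one] at hsum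
  rw [div_mul_cancel₀ _ hQ.ne']
  have h1 : ((M : ℝ) - t) ^ k / powSum a M ^ (k - 1) =
      (((M : ℝ) - t) / powSum a M) ^ k * powSum a M := by
    obtain ⟨m, rfl⟩ : ∃ m, k = m + 1 := ⟨k - 1, by omega⟩
    rw [Nat.add_sub_cancel, div_pow, pow_succ (powSum a M)]
    field_simp
  rw [h1]
  refine le_add_of_nonneg_right (mul_nonneg (by positivity) (by linarith))

/-- The excess over `powSum (-b) M` of the lower bound for `missedWeight` in the early steps. -/
def lowerHead (k : ℕ) (a b σ : ℝ) (t : ℕ) : ℝ :=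
  ((⌊(t : ℝ) / σ⌋₊ : ℝ) ^ (-a)) ^ k * powSum a ⌊(t : ℝ) / σ⌋₊ - powSum (-b) ⌊(t : ℝ) / σ⌋₊ +
    k * (⌊(t : ℝ) / σ⌋₊ : ℝ) ^ (-b) *
      (⌊(t : ℝ) / σ⌋₊ - (⌊(t : ℝ) / σ⌋₊ : ℝ) ^ (-a) * powSum a ⌊(t : ℝ) / σ⌋₊ - t)

lemma floor_div_le {σ : ℝ} (hσ0 : 0 < σ) {M t : ℕ} (ht : t ≤ ⌊σ * M⌋₊) :
    ⌊(t : ℝ) / σ⌋₊ ≤ M := by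
  refine Nat.floor_le_of_le ?_
  rw [div_le_iff₀ hσ0, mul_comm]
  exact (Nat.cast_le.2 ht).trans (Nat.floor_le (by positivity))

/-- The optimal profile is `(x / N) ^ a` up to `N = ⌊t / σ⌋₊` and `1` beyond. Beyond `N` the slope
`k * x ^ (-b)` is at most the common slope `k * N ^ (-b)` below `N`, so a single multiplier applied
to the budget handles both ranges. -/
lemma le_missedWeight_head {k : ℕ} (hk : 1 ≤ k) {a b σ : ℝ} (hab : a * (k - 1 : ℕ) = b)
    (hb : 0 < b) (hσ0 : 0 < σ) (hσ1 : σ ≤ 1) (A : Measure (ℕ → ℕ)) [IsProbabilityMeasure A]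
    {M t : ℕ} (ht1 : 1 ≤ t) (ht : t ≤ ⌊σ * M⌋₊) :
    powSum (-b) M + lowerHead k a b σ t ≤ missedWeight k b A M t := by
  have hNM := floor_div_le hσ0 ht
  have hN1 : 1 ≤ ⌊(t : ℝ) / σ⌋₊ := by
    refine Nat.le_floor ?_
    rw [le_div_iff₀ hσ0]
    have : (1 : ℝ) ≤ t := by exact_mod_cast ht1
    push_cast
    linarith
  rw [lowerHead]
  set N := ⌊(t : ℝ) / σ⌋₊
  have hN0 : 0 < (N : ℝ) := by exact_mod_cast hN1
  have hNb : 0 < (N : ℝ) ^ (-b) := by positivity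
  have h1 := tangent_le_sum hk hab (c := (N : ℝ) ^ (-a)) (by positivity)
    (F := fun x => A.real (missed x t)) (fun x => measureReal_nonneg) N
  have hc : ((N : ℝ) ^ (-a)) ^ (k - 1) = (N : ℝ) ^ (-b) := by
    rw [← Real.rpow_natCast, ← Real.rpow_mul hN0.le, neg_mul, hab]
  rw [hc] at h1
  have h2 : ∑ x ∈ Finset.Ioc N M, ((x : ℝ) ^ (-b) - k * (N : ℝ) ^ (-b) *
      (1 - A.real (missed x t))) ≤
      ∑ x ∈ Finset.Ioc N M, (x : ℝ) ^ (-b) * A.real (missed x t) ^ k := by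
    refine Finset.sum_le_sum fun x hx => ?_
    have hx' : (N : ℝ) ≤ x := by exact_mod_cast (Finset.mem_Ioc.1 hx).1.le
    have hx0 : 0 < (x : ℝ) := hN0.trans_le hx'
    have hxN : (x : ℝ) ^ (-b) ≤ (N : ℝ) ^ (-b) :=
      Real.rpow_le_rpow_of_nonpos hN0 hx' (by linarith)
    have hF := tangent_le_pow (F := A.real (missed x t)) (G := 1) measureReal_nonneg one_pos k
    simp only [one_pow, mul_one] at hF
    have hF1 : 0 ≤ 1 - A.real (missed x t) := sub_nonneg.2 measureReal_le_one
    have hxb : 0 ≤ (x : ℝ) ^ (-b) := by positivity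
    have h3 := mul_le_mul_of_nonneg_left hF hxb
    have h4 := mul_le_mul_of_nonneg_right hxN (mul_nonneg (Nat.cast_nonneg (α := ℝ) k) hF1)
    linarith
  rw [Finset.sum_sub_distrib, ← Finset.mul_sum] at h2
  have hsum := sum_one_sub_missed_le A (Finset.Icc 1 M) t
  rw [sum_Icc_one_split hNM, Finset.sum_sub_distrib] at hsum
  simp only [Finset.sum_const, Nat.card_Icc, Nat.add_sub_cancel, nsmul_eq_mul, mul_one] at hsum
  have hP : powSum (-b) M = powSum (-b) N + ∑ x ∈ Finset.Ioc N M, (x : ℝ) ^ (-b) :=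
    sum_Icc_one_split hNM _
  rw [missedWeight, sum_Icc_one_split hNM, hP]
  have h5 := mul_le_mul_of_nonneg_left hsum
    (show 0 ≤ (k : ℝ) * (N : ℝ) ^ (-b) by positivity)
  linarith

/-! ### Upper bound for the Pareto algorithm at a fixed step -/

/-- The sum of the weights `x ^ (-b)` times the `k`-th powers of `(σ x + 1) ^ a`. -/
def shiftSum (k : ℕ) (a b σ : ℝ) (n : ℕ) : ℝ :=
  ∑ x ∈ Finset.Icc 1 n, (x : ℝ) ^ (-b) * ((σ * x + 1) ^ a) ^ k

/-- The excess over `powSum (-b) M` of the upper bound for `missedWeight` in the early steps. -/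
def upperHead (k : ℕ) (a b σ : ℝ) (t : ℕ) : ℝ :=
  shiftSum k a b σ ⌊(t : ℝ) / σ⌋₊ / (((t : ℝ) + 1) ^ a) ^ k - powSum (-b) ⌊(t : ℝ) / σ⌋₊

lemma missedWeight_le_powSum (k : ℕ) (b : ℝ) (A : Measure (ℕ → ℕ)) [IsProbabilityMeasure A]
    (M t : ℕ) : missedWeight k b A M t ≤ powSum (-b) M :=
  Finset.sum_le_sum fun _ _ => mul_le_of_le_one_right (by positivity)
    (pow_le_one₀ measureReal_nonneg measureReal_le_one)

instance (σ : ℝ) (M : ℕ) : IsProbabilityMeasure (paretoAlg σ M) :=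
  PMF.toMeasure.isProbabilityMeasure _

lemma missedWeight_paretoAlg_le_head (k : ℕ) {a b σ : ℝ} (hσ0 : 0 < σ) (hσ1 : σ < 1)
    (ha : a = σ / (1 - σ)) (ha1 : a ≤ 1) {M t : ℕ} (ht : t ≤ ⌊σ * M⌋₊) :
    missedWeight k b (paretoAlg σ M) M t ≤ powSum (-b) M + upperHead k a b σ t := by
  have hNM := floor_div_le hσ0 ht
  have htM : t ≤ M := ht.trans (Nat.floor_le_of_le (mul_le_of_le_one_left (by positivity) hσ1.le))
  rw [upperHead]
  set N := ⌊(t : ℝ) / σ⌋₊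
  have hP : powSum (-b) M = powSum (-b) N + ∑ x ∈ Finset.Ioc N M, (x : ℝ) ^ (-b) :=
    sum_Icc_one_split hNM _
  have h1 : ∑ x ∈ Finset.Icc 1 N, (x : ℝ) ^ (-b) * (paretoAlg σ M).real (missed x t) ^ k ≤
      shiftSum k a b σ N / (((t : ℝ) + 1) ^ a) ^ k := by
    rw [shiftSum, Finset.sum_div]
    refine Finset.sum_le_sum fun x hx => ?_
    rw [mul_div_assoc, ← div_pow, ← Real.div_rpow (by positivity) (by positivity)]
    have hx := Finset.mem_Icc.1 hx
    gcongr
    exact (paretoAlg_missed_le σ htM x).trans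
      (missProb_le_rpow hσ0 hσ1 ha ha1 htM hx.1 (hx.2.trans hNM))
  have h2 : ∑ x ∈ Finset.Ioc N M, (x : ℝ) ^ (-b) * (paretoAlg σ M).real (missed x t) ^ k ≤
      ∑ x ∈ Finset.Ioc N M, (x : ℝ) ^ (-b) :=
    Finset.sum_le_sum fun _ _ => mul_le_of_le_one_right (by positivity)
      (pow_le_one₀ measureReal_nonneg measureReal_le_one)
  rw [missedWeight, sum_Icc_one_split hNM, hP]
  linarith

lemma missedWeight_paretoAlg_le_tail (k : ℕ) {a b σ : ℝ} (hσ0 : 0 < σ) (hσ1 : σ < 1)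
    (ha : a = σ / (1 - σ)) (ha1 : a ≤ 1) {M t : ℕ} (hst : ⌊σ * M⌋₊ ≤ t) (ht : t ≤ M) :
    missedWeight k b (paretoAlg σ M) M t ≤
      shiftSum k a b σ M / (((⌊σ * M⌋₊ : ℝ) + 1) ^ a) ^ k / ((M : ℝ) - ⌊σ * M⌋₊) ^ k *
        ((M : ℝ) - t) ^ k := by
  rw [shiftSum, Finset.sum_div, Finset.sum_div, Finset.sum_mul]
  refine Finset.sum_le_sum fun x hx => ?_
  have hx := Finset.mem_Icc.1 hx
  have h := (paretoAlg_missed_le σ ht x).trans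
    (missProb_le_rpow_mul hσ0 hσ1 ha ha1 hst ht hx.1 hx.2)
  rw [Real.div_rpow (by positivity) (by positivity)] at h
  refine (mul_le_mul_of_nonneg_left (pow_le_pow_left₀ measureReal_nonneg h k)
    (by positivity)).trans (le_of_eq ?_)
  rw [mul_pow, div_pow, div_pow]
  ring

/-- The late bound vanishes at `t = M`, and miss probabilities decrease in `t`. -/
lemma missedWeight_paretoAlg_eq_zero {k : ℕ} (hk : k ≠ 0) {b σ : ℝ} (hσ0 : 0 < σ) (hσ1 : σ < 1)
    (ha1 : σ / (1 - σ) ≤ 1) {M t : ℕ} (ht : M ≤ t) :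
    missedWeight k b (paretoAlg σ M) M t = 0 := by
  refine le_antisymm ?_ (missedWeight_nonneg _ _ _ _ _)
  have h := missedWeight_paretoAlg_le_tail k (b := b) hσ0 hσ1 rfl ha1
    (Nat.floor_le_of_le (mul_le_of_le_one_left (by positivity) hσ1.le)) le_rfl (M := M)
  rw [sub_self, zero_pow hk, mul_zero] at h
  refine le_trans (Finset.sum_le_sum fun x _ => ?_) h
  gcongr
  · exact measure_ne_top _ _
  · exact missed_anti x ht

/-! ### Leading terms of the bounds -/

lemma tendsto_floor_mul_natCast_div {c : ℝ} (hc : 0 ≤ c) :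
    Tendsto (fun n : ℕ => (⌊c * (n : ℝ)⌋₊ : ℝ) / n) atTop (𝓝 c) :=
  (tendsto_nat_floor_mul_div_atTop hc).comp tendsto_natCast_atTop_atTop

lemma tendsto_floor_mul_add_one_div {c : ℝ} (hc : 0 ≤ c) :
    Tendsto (fun n : ℕ => ((⌊c * (n : ℝ)⌋₊ : ℝ) + 1) / n) atTop (𝓝 c) := by
  have := (tendsto_floor_mul_natCast_div hc).add (tendsto_inv_atTop_nhds_zero_nat (𝕜 := ℝ))
  rw [add_zero] at this
  refine this.congr fun n => ?_
  rw [add_div, one_div]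

lemma tendsto_floor_natCast_div {σ : ℝ} (hσ0 : 0 < σ) :
    Tendsto (fun t : ℕ => (⌊(t : ℝ) / σ⌋₊ : ℝ) / t) atTop (𝓝 (1 / σ)) := by
  refine (tendsto_floor_mul_natCast_div (c := 1 / σ) (by positivity)).congr fun t => ?_
  rw [one_div_mul_eq_div]

lemma tendsto_powSum_neg {b : ℝ} (hb : b < 1) :
    Tendsto (fun n : ℕ => powSum (-b) n / (n : ℝ) ^ (1 - b)) atTop (𝓝 (1 / (1 - b))) := by
  have := tendsto_sum_rpow_div (q := -b) (by linarith)
  rwa [neg_add_eq_sub] at this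

lemma rpow_pow_eq {k : ℕ} (hk : 1 ≤ k) {a b : ℝ} (hab : a * (k - 1 : ℕ) = b) {x : ℝ}
    (hx : 0 ≤ x) : (x ^ a) ^ k = x ^ b * x ^ a := by
  rw [← hab, Real.rpow_mul hx, Real.rpow_natCast, ← pow_succ, Nat.sub_add_cancel hk]

/-- The multiplier term vanishes to leading order: the profile spends `N * (1 - 1 / (a + 1)) = σ N`,
up to lower order, and this matches the budget `t`. -/
lemma tendsto_lowerHead {k : ℕ} (hk : 1 ≤ k) {a b σ : ℝ} (hab : a * (k - 1 : ℕ) = b)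
    (ha : 0 < a) (hb : b < 1) (hσ0 : 0 < σ) (hσa : (1 + a) * (1 - σ) = 1) :
    Tendsto (fun t : ℕ => lowerHead k a b σ t / (t : ℝ) ^ (1 - b)) atTop
      (𝓝 ((1 / (a + 1) - 1 / (1 - b)) * (1 / σ) ^ (1 - b))) := by
  set f : ℕ → ℝ := fun n => ((n : ℝ) ^ (-a)) ^ k * powSum a n - powSum (-b) n +
    k * (n : ℝ) ^ (-b) * (n - (n : ℝ) ^ (-a) * powSum a n) with hf
  have hQ : Tendsto (fun n : ℕ => powSum a n / (n : ℝ) ^ (a + 1)) atTop (𝓝 (1 / (a + 1))) :=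
    tendsto_sum_rpow_div (by linarith)
  have hfl : Tendsto (fun n : ℕ => f n / (n : ℝ) ^ (1 - b)) atTop
      (𝓝 (1 / (a + 1) - 1 / (1 - b) + k * (1 - 1 / (a + 1)))) := by
    refine ((hQ.sub (tendsto_powSum_neg hb)).add ((hQ.const_sub 1).const_mul (k : ℝ))).congr' ?_
    filter_upwards [eventually_gt_atTop 0] with n hn
    have hn' : (0 : ℝ) < n := by exact_mod_cast hn
    have hna : 0 < (n : ℝ) ^ a := by positivity
    have hnb : 0 < (n : ℝ) ^ b := by positivity
    simp only [hf]
    rw [Real.rpow_neg hn'.le a, inv_pow, rpow_pow_eq hk hab hn'.le, Real.rpow_neg hn'.le b,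
      Real.rpow_sub hn', Real.rpow_one, Real.rpow_add_one hn'.ne']
    field_simp
  have h1 := tendsto_comp_div_rpow (by positivity) hfl (tendsto_floor_natCast_div hσ0)
  have h2 := tendsto_comp_div_rpow (by positivity) (tendsto_rpow_div_rpow (-b))
    (tendsto_floor_natCast_div hσ0)
  have h3 := h1.sub (h2.const_mul (k : ℝ))
  have hlim : (1 / (a + 1) - 1 / (1 - b) + k * (1 - 1 / (a + 1))) * (1 / σ) ^ (1 - b) -
      k * (1 * (1 / σ) ^ (-b)) = (1 / (a + 1) - 1 / (1 - b)) * (1 / σ) ^ (1 - b) := by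
    have e1 : (1 / σ) ^ (1 - b) = 1 / σ * (1 / σ) ^ (-b) := by
      rw [sub_eq_add_neg, Real.rpow_add (by positivity), Real.rpow_one]
    have e2 : 1 - 1 / (a + 1) = σ := by
      field_simp
      linarith
    rw [e1, e2]
    field_simp
    ring
  rw [hlim] at h3
  refine h3.congr' ?_
  filter_upwards [eventually_gt_atTop 0] with t ht
  have ht' : (0 : ℝ) < t := by exact_mod_cast ht
  have htb : 0 < (t : ℝ) ^ (-b) := by positivity
  simp only [hf, lowerHead]
  rw [sub_eq_add_neg 1 b, Real.rpow_add ht', Real.rpow_one]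
  field_simp
  ring

lemma tendsto_linear_rpow {k : ℕ} {a b σ : ℝ} (hk : 1 ≤ k) (hab : a * (k - 1 : ℕ) = b)
    (hσ0 : 0 < σ) :
    Tendsto (fun n : ℕ => (n : ℝ) ^ (-b) * ((σ * n + 1) ^ a) ^ k / (n : ℝ) ^ a) atTop
      (𝓝 ((σ ^ a) ^ k)) := by
  have h0 : Tendsto (fun n : ℕ => (σ * n + 1) / (n : ℝ)) atTop (𝓝 σ) := by
    have := (tendsto_inv_atTop_nhds_zero_nat (𝕜 := ℝ)).const_add σ
    rw [add_zero] at this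
    refine this.congr' ?_
    filter_upwards [eventually_gt_atTop 0] with n hn
    have hn' : (0 : ℝ) < n := by exact_mod_cast hn
    field_simp
  refine ((h0.rpow_const (p := a) (Or.inl hσ0.ne')).pow k).congr' ?_
  filter_upwards [eventually_gt_atTop 0] with n hn
  have hn' : (0 : ℝ) < n := by exact_mod_cast hn
  have hna : 0 < (n : ℝ) ^ a := by positivity
  have hnb : 0 < (n : ℝ) ^ b := by positivity
  rw [Real.div_rpow (by positivity) hn'.le, div_pow, rpow_pow_eq hk hab hn'.le,
    Real.rpow_neg hn'.le]
  field_simp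

lemma tendsto_shiftSum {k : ℕ} {a b σ : ℝ} (hk : 1 ≤ k) (hab : a * (k - 1 : ℕ) = b)
    (ha : 0 < a) (hσ0 : 0 < σ) :
    Tendsto (fun n : ℕ => shiftSum k a b σ n / (n : ℝ) ^ (a + 1)) atTop
      (𝓝 ((σ ^ a) ^ k / (a + 1))) :=
  tendsto_sum_Icc_div_rpow (by linarith) (tendsto_linear_rpow hk hab hσ0)

/-- The limit agrees with that of `lowerHead`, because `(σ x + 1) / (t + 1)` behaves like `x / N`
with `N = ⌊t / σ⌋₊`. -/
lemma tendsto_upperHead {k : ℕ} (hk : 1 ≤ k) {a b σ : ℝ} (hab : a * (k - 1 : ℕ) = b)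
    (ha : 0 < a) (hb : b < 1) (hσ0 : 0 < σ) :
    Tendsto (fun t : ℕ => upperHead k a b σ t / (t : ℝ) ^ (1 - b)) atTop
      (𝓝 ((1 / (a + 1) - 1 / (1 - b)) * (1 / σ) ^ (1 - b))) := by
  have hR := tendsto_comp_div_rpow (by positivity) (tendsto_shiftSum hk hab ha hσ0)
    (tendsto_floor_natCast_div hσ0)
  have hP := tendsto_comp_div_rpow (by positivity) (tendsto_powSum_neg hb)
    (tendsto_floor_natCast_div hσ0)
  have hs : Tendsto (fun t : ℕ => ((((t + 1 : ℕ) : ℝ) / t) ^ a) ^ k) atTop (𝓝 1) := by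
    simpa using (tendsto_add_one_div.rpow_const (p := a) (Or.inl one_ne_zero)).pow k
  have h := (hR.div hs one_ne_zero).sub hP
  have hlim : (σ ^ a) ^ k / (a + 1) * (1 / σ) ^ (a + 1) / 1 - 1 / (1 - b) * (1 / σ) ^ (1 - b) =
      (1 / (a + 1) - 1 / (1 - b)) * (1 / σ) ^ (1 - b) := by
    have hsa : 0 < σ ^ a := by positivity
    have hsb : 0 < σ ^ b := by positivity
    have e : (σ ^ a) ^ k * (1 / σ) ^ (a + 1) = (1 / σ) ^ (1 - b) := by
      rw [rpow_pow_eq hk hab hσ0.le, one_div, Real.inv_rpow hσ0.le, Real.inv_rpow hσ0.le,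
        Real.rpow_add_one hσ0.ne', Real.rpow_sub hσ0, Real.rpow_one]
      field_simp
    rw [div_one, div_mul_eq_mul_div, e]
    ring
  rw [hlim] at h
  refine h.congr' ?_
  filter_upwards [eventually_gt_atTop 0] with t ht
  have ht' : (0 : ℝ) < t := by exact_mod_cast ht
  have hta : 0 < (t : ℝ) ^ a := by positivity
  have htb : 0 < (t : ℝ) ^ b := by positivity
  simp only [upperHead, Pi.div_apply]
  rw [Real.div_rpow (by positivity) ht'.le, div_pow, rpow_pow_eq hk hab ht'.le, sub_div,
    Real.rpow_add_one ht'.ne', Real.rpow_sub ht', Real.rpow_one]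
  push_cast
  field_simp

/-- The total of the early steps, for both the lower and the upper bound. -/
lemma tendsto_head {b σ L : ℝ} {B u : ℕ → ℝ} (hb : b < 1) (hσ0 : 0 < σ)
    (hu : Tendsto (fun M : ℕ => u M / M) atTop (𝓝 σ))
    (hB : Tendsto (fun t : ℕ => B t / (t : ℝ) ^ (1 - b)) atTop (𝓝 (L * (1 / σ) ^ (1 - b)))) :
    Tendsto (fun M : ℕ => (u M * powSum (-b) M + ∑ t ∈ Finset.Icc 1 ⌊σ * (M : ℝ)⌋₊, B t) /
      (M : ℝ) ^ (2 - b)) atTop (𝓝 (σ / (1 - b) + σ * L / (2 - b))) := by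
  have h1 := tendsto_comp_div_rpow hσ0 (tendsto_sum_Icc_div_rpow (by linarith) hB)
    (tendsto_floor_mul_natCast_div hσ0.le)
  have e2 : 1 - b + 1 = 2 - b := by ring
  rw [e2] at h1
  have h2 := (hu.mul (tendsto_powSum_neg hb)).add h1
  have hlim : σ * (1 / (1 - b)) + L * (1 / σ) ^ (1 - b) / (2 - b) * σ ^ (2 - b) =
      σ / (1 - b) + σ * L / (2 - b) := by
    have : σ ^ (2 - b) = σ * σ ^ (1 - b) := by
      rw [← e2, Real.rpow_add_one hσ0.ne', mul_comm]
    have hs : 0 < σ ^ (1 - b) := by positivity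
    rw [this, one_div, one_div, Real.inv_rpow hσ0.le]
    field_simp
  rw [hlim] at h2
  refine h2.congr' ?_
  filter_upwards [eventually_gt_atTop 0] with M hM
  have hM' : (0 : ℝ) < M := by exact_mod_cast hM
  have : (M : ℝ) ^ (2 - b) = M * (M : ℝ) ^ (1 - b) := by
    rw [← e2, Real.rpow_add_one hM'.ne', mul_comm]
  rw [add_div, div_mul_div_comm, this]

/-- The sum of the `k`-th powers of the numbers of steps left in the late steps. -/
lemma tendsto_tail_pow (k : ℕ) {σ : ℝ} (hσ0 : 0 < σ) (hσ1 : σ < 1) :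
    Tendsto (fun M : ℕ => (∑ t ∈ Finset.Ico (⌊σ * (M : ℝ)⌋₊ + 1) M, ((M : ℝ) - t) ^ k) /
      (M : ℝ) ^ ((k : ℝ) + 1)) atTop (𝓝 ((1 - σ) ^ (k + 1) / (k + 1))) := by
  have hlt : ∀ᶠ M : ℕ in atTop, ⌊σ * (M : ℝ)⌋₊ + 1 ≤ M := by
    filter_upwards [eventually_gt_atTop 0] with M hM
    have hM' : (0 : ℝ) < M := by exact_mod_cast hM
    have : (⌊σ * (M : ℝ)⌋₊ : ℝ) < M :=
      (Nat.floor_le (by positivity)).trans_lt (by nlinarith)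
    exact_mod_cast this
  have hu : Tendsto (fun M : ℕ => ((M - (⌊σ * (M : ℝ)⌋₊ + 1) : ℕ) : ℝ) / M) atTop
      (𝓝 (1 - σ)) := by
    have h := ((tendsto_floor_mul_natCast_div hσ0.le).const_sub 1).sub
      (tendsto_inv_atTop_nhds_zero_nat (𝕜 := ℝ))
    rw [sub_zero] at h
    refine h.congr' ?_
    filter_upwards [hlt, eventually_gt_atTop 0] with M hM hM0
    have hM' : (0 : ℝ) < M := by exact_mod_cast hM0
    rw [Nat.cast_sub hM]
    push_cast
    field_simp
    ring
  have h := tendsto_comp_div_rpow (sub_pos.2 hσ1)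
    (tendsto_sum_rpow_div (q := k) (by linarith [Nat.cast_nonneg (α := ℝ) k])) hu
  have hlim : 1 / ((k : ℝ) + 1) * (1 - σ) ^ ((k : ℝ) + 1) = (1 - σ) ^ (k + 1) / (k + 1) := by
    rw [one_div_mul_eq_div]
    norm_cast
  rw [hlim] at h
  refine h.congr' ?_
  filter_upwards [hlt] with M hM
  congr 1
  refine Finset.sum_nbij' (fun j => M - j) (fun t => M - t) ?_ ?_ ?_ ?_ ?_
  · intro j hj; rw [Finset.mem_Icc] at hj; rw [Finset.mem_Ico]; omega
  · intro j hj; rw [Finset.mem_Ico] at hj; rw [Finset.mem_Icc]; omega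
  · intro j hj; rw [Finset.mem_Icc] at hj; omega
  · intro j hj; rw [Finset.mem_Ico] at hj; omega
  · intro j hj
    rw [Finset.mem_Icc] at hj
    rw [Real.rpow_natCast, Nat.cast_sub (by omega)]
    ring

lemma tendsto_lowerTail {k : ℕ} (hk : 1 ≤ k) {a b σ : ℝ} (hab : a * (k - 1 : ℕ) = b)
    (ha : 0 < a) (hσ0 : 0 < σ) (hσ1 : σ < 1) (hσa : (1 + a) * (1 - σ) = 1) :
    Tendsto (fun M : ℕ =>
      (∑ t ∈ Finset.Ico (⌊σ * (M : ℝ)⌋₊ + 1) M, ((M : ℝ) - t) ^ k / powSum a M ^ (k - 1)) /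
        (M : ℝ) ^ (2 - b)) atTop (𝓝 ((1 - σ) ^ 2 / (k + 1))) := by
  have hQ : Tendsto (fun n : ℕ => powSum a n / (n : ℝ) ^ (a + 1)) atTop (𝓝 (1 / (a + 1))) :=
    tendsto_sum_rpow_div (by linarith)
  have h := (tendsto_tail_pow k hσ0 hσ1).div (hQ.pow (k - 1)) (by positivity)
  have e1 : 1 / (a + 1) = 1 - σ := by field_simp; linarith
  have hσ1' : 0 < 1 - σ := by linarith
  have hlim : (1 - σ) ^ (k + 1) / ((k : ℝ) + 1) / (1 / (a + 1)) ^ (k - 1) =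
      (1 - σ) ^ 2 / (k + 1) := by
    obtain ⟨m, rfl⟩ : ∃ m, k = m + 1 := ⟨k - 1, by omega⟩
    rw [e1, Nat.add_sub_cancel]
    field_simp
    ring
  rw [hlim] at h
  refine h.congr' ?_
  filter_upwards [eventually_gt_atTop 0] with M hM
  have hM' : (0 : ℝ) < M := by exact_mod_cast hM
  have hQ0 := powSum_pos a hM
  have hMb : 0 < (M : ℝ) ^ b := by positivity
  -- The exponents match because `(a + 1) * (k - 1) + 2 - b = k + 1`.
  have e3 : ((M : ℝ) ^ (a + 1)) ^ (k - 1) * (M : ℝ) ^ (2 - b) = (M : ℝ) ^ ((k : ℝ) + 1) := by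
    rw [← Real.rpow_natCast, ← Real.rpow_mul hM'.le, ← Real.rpow_add hM']
    congr 1
    rw [add_mul, hab, Nat.cast_sub hk]
    push_cast
    ring
  simp only [Pi.div_apply]
  rw [← Finset.sum_div, ← e3, div_pow]
  have : 0 < (M : ℝ) ^ (a + 1) := by positivity
  have : 0 < (M : ℝ) ^ (2 - b) := by positivity
  field_simp

lemma tendsto_upperTail {k : ℕ} (hk : 1 ≤ k) {a b σ : ℝ} (hab : a * (k - 1 : ℕ) = b)
    (ha : 0 < a) (hσ0 : 0 < σ) (hσ1 : σ < 1) (hσa : (1 + a) * (1 - σ) = 1) :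
    Tendsto (fun M : ℕ =>
      (∑ t ∈ Finset.Ico (⌊σ * (M : ℝ)⌋₊ + 1) M,
        shiftSum k a b σ M / (((⌊σ * (M : ℝ)⌋₊ : ℝ) + 1) ^ a) ^ k /
          ((M : ℝ) - ⌊σ * (M : ℝ)⌋₊) ^ k * ((M : ℝ) - t) ^ k) /
        (M : ℝ) ^ (2 - b)) atTop (𝓝 ((1 - σ) ^ 2 / (k + 1))) := by
  have hfl := tendsto_floor_mul_natCast_div hσ0.le
  have hfl1 := tendsto_floor_mul_add_one_div hσ0.le
  have hσ1' : 0 < 1 - σ := by linarith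
  have hd1 := (hfl1.rpow_const (p := a) (Or.inl hσ0.ne')).pow k
  have hd2 := (hfl.const_sub 1).pow k
  have h := (((tendsto_shiftSum hk hab ha hσ0).div hd1 (by positivity)).div hd2
    (by positivity)).mul (tendsto_tail_pow k hσ0 hσ1)
  have hlim : (σ ^ a) ^ k / (a + 1) / (σ ^ a) ^ k / (1 - σ) ^ k *
      ((1 - σ) ^ (k + 1) / (k + 1)) = (1 - σ) ^ 2 / (k + 1) := by
    have e1 : (1 - σ) ^ 2 = (1 - σ) / (a + 1) := by
      field_simp; linarith
    have : 0 < σ ^ a := by positivity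
    rw [e1, pow_succ]
    field_simp
  rw [hlim] at h
  refine h.congr' ?_
  filter_upwards [eventually_gt_atTop 0] with M hM
  have hM' : (0 : ℝ) < M := by exact_mod_cast hM
  have hs1 : (⌊σ * (M : ℝ)⌋₊ : ℝ) < M :=
    (Nat.floor_le (by positivity)).trans_lt (by nlinarith)
  have hMs : 0 < (M : ℝ) - ⌊σ * (M : ℝ)⌋₊ := by linarith
  have hMa : 0 < (M : ℝ) ^ a := by positivity
  have hMb : 0 < (M : ℝ) ^ b := by positivity
  have e2 : (M : ℝ) ^ (2 - b) = M * M / (M : ℝ) ^ b := by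
    rw [Real.rpow_sub hM', Real.rpow_two, sq]
  have e3 : 1 - (⌊σ * (M : ℝ)⌋₊ : ℝ) / M = ((M : ℝ) - ⌊σ * (M : ℝ)⌋₊) / M := by
    field_simp
  simp only [Pi.div_apply]
  rw [← Finset.mul_sum, Real.div_rpow (by positivity) hM'.le, div_pow (_ ^ a),
    rpow_pow_eq hk hab hM'.le, e2, e3, div_pow _ (M : ℝ), Real.rpow_add_one hM'.ne',
    Real.rpow_add_one hM'.ne', Real.rpow_natCast]
  field_simp

/-- Box `x` is found at a time between `x / k` and `x / k + 1`. -/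
lemma tendsto_cordSum {k : ℕ} (hk : 1 ≤ k) {b : ℝ} (hb : b < 1) :
    Tendsto (fun M : ℕ =>
      (∑ x ∈ Finset.Icc 1 M, (x : ℝ) ^ (-b) * ((((x - 1) / k : ℕ) : ℝ) + 1)) /
        (M : ℝ) ^ (2 - b)) atTop (𝓝 (1 / k / (2 - b))) := by
  have hk' : (0 : ℝ) < k := by exact_mod_cast hk
  have h0 : Tendsto (fun x : ℕ => ((((x - 1) / k : ℕ) : ℝ) + 1) / x) atTop (𝓝 (1 / k)) := by
    have hup : Tendsto (fun x : ℕ => 1 / (k : ℝ) + (x : ℝ)⁻¹) atTop (𝓝 (1 / k)) := by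
      simpa using (tendsto_inv_atTop_nhds_zero_nat (𝕜 := ℝ)).const_add (1 / (k : ℝ))
    refine tendsto_of_tendsto_of_tendsto_of_le_of_le' tendsto_const_nhds hup ?_ ?_
    · filter_upwards [eventually_gt_atTop 0] with x hx
      have hx' : (0 : ℝ) < x := by exact_mod_cast hx
      rw [div_le_div_iff₀ hk' hx', one_mul]
      have h1 := Nat.div_add_mod' (x - 1) k
      have h2 := Nat.mod_lt (x - 1) hk
      have h3 : x ≤ ((x - 1) / k + 1) * k := by
        rw [add_mul, one_mul]
        omega
      exact_mod_cast h3
    · filter_upwards [eventually_gt_atTop 0] with x hx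
      have hx' : (0 : ℝ) < x := by exact_mod_cast hx
      rw [add_div, one_div (x : ℝ)]
      refine add_le_add_left ?_ _
      rw [div_le_div_iff₀ hx' hk', one_mul]
      have h1 := Nat.div_mul_le_self (x - 1) k
      have h3 : (x - 1) / k * k ≤ x := by omega
      exact_mod_cast h3
  have e : 1 - b + 1 = 2 - b := by ring
  have h := tendsto_sum_Icc_div_rpow (q := 1 - b)
    (h := fun x : ℕ => (x : ℝ) ^ (-b) * ((((x - 1) / k : ℕ) : ℝ) + 1)) (L := 1 / k)
    (by linarith) ?_
  · rwa [e] at h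
  · refine h0.congr' ?_
    filter_upwards [eventually_gt_atTop 0] with x hx
    have hx' : (0 : ℝ) < x := by exact_mod_cast hx
    have : 0 < (x : ℝ) ^ (-b) := by positivity
    rw [sub_eq_add_neg, Real.rpow_add hx', Real.rpow_one]
    field_simp

lemma floor_mul_lt {σ : ℝ} (hσ0 : 0 < σ) (hσ1 : σ < 1) {M : ℕ} (hM : 1 ≤ M) :
    ⌊σ * (M : ℝ)⌋₊ < M := by
  have hM' : (0 : ℝ) < M := by exact_mod_cast hM
  rw [Nat.floor_lt (by positivity)]
  nlinarith

lemma sum_range_split {s M : ℕ} (h : s < M) (f : ℕ → ℝ) :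
    ∑ t ∈ Finset.range M, f t =
      f 0 + ∑ t ∈ Finset.Icc 1 s, f t + ∑ t ∈ Finset.Ico (s + 1) M, f t := by
  rw [← Finset.Ico_add_one_right_eq_Icc, Finset.range_eq_Ico,
    ← Finset.sum_Ico_consecutive f (Nat.zero_le (s + 1)) h,
    Finset.sum_eq_sum_Ico_succ_bot (Nat.succ_pos s), zero_add, Nat.succ_eq_add_one]

/-! ### Summation over the steps and conclusion -/

/-- A lower bound for the unnormalized running time of every non-coordinating algorithm. -/
def lowerTotal (k : ℕ) (a b σ : ℝ) (M : ℕ) : ℝ :=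
  ⌊σ * (M : ℝ)⌋₊ * powSum (-b) M + ∑ t ∈ Finset.Icc 1 ⌊σ * (M : ℝ)⌋₊, lowerHead k a b σ t +
    ∑ t ∈ Finset.Ico (⌊σ * (M : ℝ)⌋₊ + 1) M, ((M : ℝ) - t) ^ k / powSum a M ^ (k - 1)

lemma ofReal_lowerTotal_le {k : ℕ} (hk : 1 ≤ k) {a b σ : ℝ} (hab : a * (k - 1 : ℕ) = b)
    (hb : 0 < b) (hσ0 : 0 < σ) (hσ1 : σ < 1) (A : Measure (ℕ → ℕ)) [IsProbabilityMeasure A]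
    {M : ℕ} (hM : 1 ≤ M) :
    ENNReal.ofReal (lowerTotal k a b σ M) ≤ weightedTime b M (nonCoordinating k A) := by
  rw [weightedTime_nonCoordinating]
  refine le_trans ?_ (ENNReal.sum_le_tsum (Finset.range M))
  rw [← ENNReal.ofReal_sum_of_nonneg fun t _ => missedWeight_nonneg _ _ _ _ _]
  refine ENNReal.ofReal_le_ofReal ?_
  rw [sum_range_split (floor_mul_lt hσ0 hσ1 hM), lowerTotal]
  -- The step `t = 0` is dropped here; in the upper bound it costs one extra `powSum (-b) M`, which
  -- is of lower order.
  have h0 := missedWeight_nonneg k b A M 0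
  have h1 : ∑ t ∈ Finset.Icc 1 ⌊σ * (M : ℝ)⌋₊, (powSum (-b) M + lowerHead k a b σ t) ≤
      ∑ t ∈ Finset.Icc 1 ⌊σ * (M : ℝ)⌋₊, missedWeight k b A M t :=
    Finset.sum_le_sum fun t ht => le_missedWeight_head hk hab hb hσ0 hσ1.le A
      (Finset.mem_Icc.1 ht).1 (Finset.mem_Icc.1 ht).2
  rw [Finset.sum_add_distrib] at h1
  simp only [Finset.sum_const, Nat.card_Icc, Nat.add_sub_cancel, nsmul_eq_mul] at h1
  have h2 : ∑ t ∈ Finset.Ico (⌊σ * (M : ℝ)⌋₊ + 1) M, ((M : ℝ) - t) ^ k / powSum a M ^ (k - 1) ≤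
      ∑ t ∈ Finset.Ico (⌊σ * (M : ℝ)⌋₊ + 1) M, missedWeight k b A M t :=
    Finset.sum_le_sum fun t ht => le_missedWeight_tail hk hab A (Finset.mem_Ico.1 ht).2
  linarith

/-- An upper bound for the unnormalized running time of `paretoAlg`. -/
def upperTotal (k : ℕ) (a b σ : ℝ) (M : ℕ) : ℝ :=
  ((⌊σ * (M : ℝ)⌋₊ : ℝ) + 1) * powSum (-b) M +
      ∑ t ∈ Finset.Icc 1 ⌊σ * (M : ℝ)⌋₊, upperHead k a b σ t +
    ∑ t ∈ Finset.Ico (⌊σ * (M : ℝ)⌋₊ + 1) M,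
      shiftSum k a b σ M / (((⌊σ * (M : ℝ)⌋₊ : ℝ) + 1) ^ a) ^ k /
        ((M : ℝ) - ⌊σ * (M : ℝ)⌋₊) ^ k * ((M : ℝ) - t) ^ k

lemma weightedTime_paretoAlg_le {k : ℕ} (hk : 1 ≤ k) {a b σ : ℝ} (hσ0 : 0 < σ) (hσ1 : σ < 1)
    (ha : a = σ / (1 - σ)) (ha1 : a ≤ 1) {M : ℕ} (hM : 1 ≤ M) :
    weightedTime b M (nonCoordinating k (paretoAlg σ M)) ≤
      ENNReal.ofReal (upperTotal k a b σ M) := by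
  rw [weightedTime_nonCoordinating, tsum_eq_sum (s := Finset.range M),
    ← ENNReal.ofReal_sum_of_nonneg fun t _ => missedWeight_nonneg _ _ _ _ _]
  · refine ENNReal.ofReal_le_ofReal ?_
    rw [sum_range_split (floor_mul_lt hσ0 hσ1 hM), upperTotal]
    have h0 := missedWeight_le_powSum k b (paretoAlg σ M) M 0
    have h1 : ∑ t ∈ Finset.Icc 1 ⌊σ * (M : ℝ)⌋₊, missedWeight k b (paretoAlg σ M) M t ≤
        ∑ t ∈ Finset.Icc 1 ⌊σ * (M : ℝ)⌋₊, (powSum (-b) M + upperHead k a b σ t) :=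
      Finset.sum_le_sum fun t ht => missedWeight_paretoAlg_le_head k hσ0 hσ1 ha ha1
        (Finset.mem_Icc.1 ht).2
    rw [Finset.sum_add_distrib] at h1
    simp only [Finset.sum_const, Nat.card_Icc, Nat.add_sub_cancel, nsmul_eq_mul] at h1
    have h2 := Finset.sum_le_sum fun t (ht : t ∈ Finset.Ico (⌊σ * (M : ℝ)⌋₊ + 1) M) =>
      missedWeight_paretoAlg_le_tail k (b := b) hσ0 hσ1 ha ha1
        (Nat.le_of_succ_le (Finset.mem_Ico.1 ht).1) (Finset.mem_Ico.1 ht).2.le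
    linarith
  · intro t ht
    rw [missedWeight_paretoAlg_eq_zero (by omega) hσ0 hσ1 (ha ▸ ha1) (by simpa using ht),
      ENNReal.ofReal_zero]

lemma tendsto_lowerTotal {k : ℕ} (hk : 1 ≤ k) {a b σ : ℝ} (hab : a * (k - 1 : ℕ) = b)
    (ha : 0 < a) (hb : b < 1) (hσ0 : 0 < σ) (hσ1 : σ < 1) (hσa : (1 + a) * (1 - σ) = 1) :
    Tendsto (fun M : ℕ => lowerTotal k a b σ M / (M : ℝ) ^ (2 - b)) atTop
      (𝓝 (σ / (1 - b) + σ * (1 / (a + 1) - 1 / (1 - b)) / (2 - b) + (1 - σ) ^ 2 / (k + 1))) := by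
  simp only [lowerTotal, add_div _ (∑ t ∈ Finset.Ico _ _, _)]
  exact (tendsto_head hb hσ0 (tendsto_floor_mul_natCast_div hσ0.le)
    (tendsto_lowerHead hk hab ha hb hσ0 hσa)).add (tendsto_lowerTail hk hab ha hσ0 hσ1 hσa)

lemma tendsto_upperTotal {k : ℕ} (hk : 1 ≤ k) {a b σ : ℝ} (hab : a * (k - 1 : ℕ) = b)
    (ha : 0 < a) (hb : b < 1) (hσ0 : 0 < σ) (hσ1 : σ < 1) (hσa : (1 + a) * (1 - σ) = 1) :
    Tendsto (fun M : ℕ => upperTotal k a b σ M / (M : ℝ) ^ (2 - b)) atTop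
      (𝓝 (σ / (1 - b) + σ * (1 / (a + 1) - 1 / (1 - b)) / (2 - b) + (1 - σ) ^ 2 / (k + 1))) := by
  simp only [upperTotal, add_div _ (∑ t ∈ Finset.Ico _ _, _)]
  exact (tendsto_head hb hσ0 (tendsto_floor_mul_add_one_div hσ0.le)
    (tendsto_upperHead hk hab ha hb hσ0)).add (tendsto_upperTail hk hab ha hσ0 hσ1 hσa)

lemma tendsto_ofReal_div_weightedTime_cord {k : ℕ} (hk : 1 ≤ k) {b : ℝ} (hb : b < 1) {f : ℕ → ℝ}
    {T : ℝ} (hf : Tendsto (fun M : ℕ => f M / (M : ℝ) ^ (2 - b)) atTop (𝓝 T)) :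
    Tendsto (fun M : ℕ => ENNReal.ofReal (f M) / weightedTime b M (cord k)) atTop
      (𝓝 (ENNReal.ofReal (T * (k * (2 - b))))) := by
  have hk' : (0 : ℝ) < k := by exact_mod_cast hk
  have hb' : 0 < 2 - b := by linarith
  have h := hf.div (tendsto_cordSum hk hb) (by positivity)
  have e : T / (1 / k / (2 - b)) = T * (k * (2 - b)) := by field_simp
  rw [e] at h
  refine (ENNReal.tendsto_ofReal h).congr' ?_
  filter_upwards [eventually_gt_atTop 0] with M hM
  have hM' : (0 : ℝ) < M := by exact_mod_cast hM
  have hpos : 0 < ∑ x ∈ Finset.Icc 1 M, (x : ℝ) ^ (-b) * ((((x - 1) / k : ℕ) : ℝ) + 1) := by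
    refine Finset.sum_pos (fun x hx => ?_) ⟨1, by simp; omega⟩
    have : 0 < (x : ℝ) := by exact_mod_cast (Finset.mem_Icc.1 hx).1
    positivity
  rw [weightedTime_cord hk, ← ENNReal.ofReal_div_of_pos hpos]
  simp only [Pi.div_apply]
  rw [div_div_div_cancel_right₀ (by positivity)]

end ParallelSearch

end

open ParallelSearch in
theorem mainTheorem1 (k : ℕ) (hk : 2 ≤ k) (b : ℝ) (hb0 : 0 < b) (hb1 : b < 1)
    (σ : ℝ) (hσ : σ = b / (b + k - 1)) :
    Tendsto
      (fun M : ℕ =>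
        ParallelSearch.expectedTime (ParallelSearch.paretoDist M b)
            (ParallelSearch.nonCoordinating k (ParallelSearch.paretoAlg σ M)) /
          ParallelSearch.expectedTime (ParallelSearch.paretoDist M b) (ParallelSearch.cord k))
      atTop
      (𝓝 (ENNReal.ofReal
        (k * σ * (2 - σ) + (k : ℝ) / (k + 1) * (2 - b) * (1 - σ) ^ 2))) ∧
    ∀ A : ℕ → Measure (ℕ → ℕ), (∀ M, IsProbabilityMeasure (A M)) →
      ENNReal.ofReal (k * σ * (2 - σ) + (k : ℝ) / (k + 1) * (2 - b) * (1 - σ) ^ 2) ≤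
        liminf
          (fun M : ℕ =>
            ParallelSearch.expectedTime (ParallelSearch.paretoDist M b)
                (ParallelSearch.nonCoordinating k (A M)) /
              ParallelSearch.expectedTime (ParallelSearch.paretoDist M b)
                (ParallelSearch.cord k))
          atTop := by
  have hk1 : 1 ≤ k := by omega
  have hk2 : (2 : ℝ) ≤ k := by exact_mod_cast hk
  -- The exponent of the optimal profile; it satisfies `σ = a / (1 + a)`.
  obtain ⟨a, ha⟩ : ∃ a : ℝ, a = b / (k - 1) := ⟨_, rfl⟩
  have hkm : 0 < (k : ℝ) - 1 := by linarith
  have hbk : 0 < b + k - 1 := by linarith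
  have hab : a * (k - 1 : ℕ) = b := by
    rw [ha, Nat.cast_sub hk1, Nat.cast_one, div_mul_cancel₀ _ hkm.ne']
  have ha0 : 0 < a := by rw [ha]; positivity
  have ha1 : a ≤ 1 := by rw [ha, div_le_one hkm]; linarith
  have hσ0 : 0 < σ := by rw [hσ]; positivity
  have hσ1 : σ < 1 := by rw [hσ, div_lt_one hbk]; linarith
  have hσ1' : 1 - σ = (k - 1) / (b + k - 1) := by rw [hσ]; field_simp; ring
  have hσa : (1 + a) * (1 - σ) = 1 := by rw [hσ1', ha]; field_simp; ring
  have haσ : a = σ / (1 - σ) := by rw [hσ1', ha, hσ]; field_simp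
  have hlim : (σ / (1 - b) + σ * (1 / (a + 1) - 1 / (1 - b)) / (2 - b) + (1 - σ) ^ 2 / (k + 1)) *
      (k * (2 - b)) = k * σ * (2 - σ) + (k : ℝ) / (k + 1) * (2 - b) * (1 - σ) ^ 2 := by
    have e1 : 1 / (a + 1) = 1 - σ := by field_simp; linarith
    have hb1' : 1 - b ≠ 0 := by linarith
    have hb2 : 2 - b ≠ 0 := by linarith
    rw [e1]
    field_simp
    ring
  have hlow := tendsto_ofReal_div_weightedTime_cord hk1 hb1
    (tendsto_lowerTotal hk1 hab ha0 hb1 hσ0 hσ1 hσa)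
  have hupp := tendsto_ofReal_div_weightedTime_cord hk1 hb1
    (tendsto_upperTotal hk1 hab ha0 hb1 hσ0 hσ1 hσa)
  rw [hlim] at hlow hupp
  have hle : ∀ A : ℕ → Measure (ℕ → ℕ), (∀ M, IsProbabilityMeasure (A M)) →
      ∀ᶠ M : ℕ in atTop, ENNReal.ofReal (lowerTotal k a b σ M) / weightedTime b M (cord k) ≤
        expectedTime (paretoDist M b) (nonCoordinating k (A M)) /
          expectedTime (paretoDist M b) (cord k) := by
    intro A hA
    filter_upwards [eventually_ge_atTop 1] with M hM
    rw [expectedTime_div_expectedTime b hM]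
    exact ENNReal.div_le_div_right (ofReal_lowerTotal_le hk1 hab hb0 hσ0 hσ1 (A M) hM) _
  -- The Pareto algorithm is itself non-coordinating, so the universal lower bound is also the lower
  -- half of the squeeze.
  refine ⟨tendsto_of_tendsto_of_tendsto_of_le_of_le' hlow hupp
    (hle _ fun M => inferInstance) ?_, fun A hA => ?_⟩
  · filter_upwards [eventually_ge_atTop 1] with M hM
    rw [expectedTime_div_expectedTime b hM]
    exact ENNReal.div_le_div_right (weightedTime_paretoAlg_le hk1 hσ0 hσ1 haσ ha1 hM) _
  · rw [← hlow.liminf_eq]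
    exact liminf_le_liminf (hle A hA)
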